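/- **Setting.** Let $n\ge 1$, let $S=\{i_1<\dots<i_m\}\subseteq\{1,\dots,n\}$ be the set of indices of the controlled vehicles (CAVs) among $n$ vehicles following a head vehicle, and let $\alpha_1>0$, $\alpha_2>\alpha_3>0$. The state is $x=(\tilde s_1,\tilde v_1,\dots,\tilde s_n,\tilde v_n)^\top\in\mathbb R^{2n}$ (spacing and velocity errors), the control input is $u\in\mathbb R^m$ (accelerations of the CAVs), the external input is $\epsilon\in\mathbb R$ (velocity error of the head vehicle), and the output is $y=(\tilde v_1,\dots,\tilde v_n,\tilde s_{i_1},\dots,\tilde s_{i_m})^\top\in\mathbb R^{n+m}$. The linearized mixed-traffic system is $\dot x=Ax+Bu+H\epsilon$, $y=Cx$, where $A\in\mathbb R^{2n\times 2n}$ is block lower bidiagonal with $2\times2$ diagonal blocks $A_{i,1}$ ($1\le i\le n$) and subdiagonal blocks $A_{i,2}$ in block position $(i,i-1)$ ($2\le i\le n$), $$A_{i,1}=\begin{bmatrix}0&-1\\ \alpha_1&-\alpha_2\end{bmatrix},\quad A_{i,2}=\begin{bmatrix}0&1\\0&\alpha_3\end{bmatrix}\quad(i\notin S),\qquad A_{i,1}=\begin{bmatrix}0&-1\\0&0\end{bmatrix},\quad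 A_{i,2}=\begin{bmatrix}0&1\\0&0\end{bmatrix}\quad(i\in S),$$ $B=[e_{2i_1},\dots,e_{2i_m}]$, $C=[e_2,e_4,\dots,e_{2n},e_{2i_1-1},\dots,e_{2i_m-1}]^\top$ with $e_j$ the unit vectors of $\mathbb R^{2n}$, and $H=(1,\eta,0,\dots,0)^\top$ with $\eta=\alpha_3$; if $1\in S$, the value $\eta=0$ is allowed as well. For a sampling time $\Delta t>0$, the discretized system is $$x(k+1)=A_{\mathrm d}x(k)+B_{\mathrm d}u(k)+H_{\mathrm d}\epsilon(k),\qquad y(k)=Cx(k),$$ with $A_{\mathrm d}=e^{A\Delta t}$, $B_{\mathrm d}=\int_0^{\Delta t}e^{At}B\,dt$, $H_{\mathrm d}=\int_0^{\Delta t}e^{At}H\,dt$. A length-$L$ trajectory is a triple of sequences $(u,\epsilon,y)$ of length $L$ that satisfies these equations for some state sequence $x$ (with arbitrary initial state). For a vector signal $\omega=(\omega(1),\dots,\omega(T))$ and $l\le T$, let $\mathcal H_l(\omega)$ be the Hankel matrix with $l$ block rows and $T-l+1$ columns whose block in position $(a,b)$ is $\omega(a+b-1)$; $\omega$ is persistently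 exciting of order $l$ if $l\le T$ and $\mathcal H_l(\omega)$ has full row rank. **Assumptions.** Let $T_{\mathrm{ini}},N,T\in\mathbb N$ and let $(u^{\mathrm d},\epsilon^{\mathrm d},y^{\mathrm d})$ be a length-$T$ trajectory of the discretized system. Suppose that 1. $\alpha_1-\alpha_2\alpha_3+\alpha_3^2\ne0$; 2. for any two complex eigenvalues $\lambda,\mu$ of $A$ with $\operatorname{Re}(\lambda-\mu)=0$ one has $|\operatorname{Im}(\lambda-\mu)|\neq 2\pi k/\Delta t$ for all $k=1,2,\dots$; 3. the combined input $\hat u^{\mathrm d}(k)=\mathrm{col}(\epsilon^{\mathrm d}(k),u^{\mathrm d}(k))$ is persistently exciting of order $T_{\mathrm{ini}}+N+2n$. Let $U_{\mathrm p},E_{\mathrm p},Y_{\mathrm p}$ and $U_{\mathrm f},E_{\mathrm f},Y_{\mathrm f}$ consist of the first $T_{\mathrm{ini}}$ and the last $N$ block rows of $\mathcal H_{T_{\mathrm{ini}}+N}(u^{\mathrm d})$, $\mathcal H_{T_{\mathrm{ini}}+N}(\epsilon^{\mathrm d})$, $\mathcal H_{T_{\mathrm{ini}}+N}(y^{\mathrm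 d})$, respectively. **Proposition 2.** Let $u_{\mathrm{ini}},\epsilon_{\mathrm{ini}},y_{\mathrm{ini}}$ be sequences of length $T_{\mathrm{ini}}$ and $u,\epsilon,y$ sequences of length $N$, with values in the respective spaces. Their concatenation, $(u_{\mathrm{ini}},\epsilon_{\mathrm{ini}},y_{\mathrm{ini}})$ followed by $(u,\epsilon,y)$, is a length-$(T_{\mathrm{ini}}+N)$ trajectory of the discretized system if and only if there is $g\in\mathbb R^{T-T_{\mathrm{ini}}-N+1}$ with $$\begin{bmatrix}U_{\mathrm p}\\E_{\mathrm p}\\Y_{\mathrm p}\\U_{\mathrm f}\\E_{\mathrm f}\\Y_{\mathrm f}\end{bmatrix}g=\begin{bmatrix}u_{\mathrm{ini}}\\\epsilon_{\mathrm{ini}}\\y_{\mathrm{ini}}\\u\\\epsilon\\y\end{bmatrix}.\qquad(*)$$ In particular every length-$(T_{\mathrm{ini}}+N)$ trajectory lies in the range of the stacked data matrix. If moreover $T_{\mathrm{ini}}\ge 2n$, then for all $u_{\mathrm{ini}},\epsilon_{\mathrm{ini}},y_{\mathrm{ini}},u,\epsilon$ there is at most one $y$ for which $(*)$ is solvable in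 $g$. -/

import Mathlib

open scoped Matrix

noncomputable section

namespace MixedTraffic

/-- State coordinates of the `n` following vehicles, in the order `s₁, v₁, s₂, v₂, …, sₙ, vₙ`:
`(i, 0)` is the spacing error and `(i, 1)` the velocity error of vehicle `i`
(the vehicles `1, …, n` are the elements `0, …, n - 1` of `Fin n`). -/
abbrev StateIdx (n : ℕ) : Type := Fin n × Fin 2

/-- Output coordinates: the velocity errors of all vehicles, then the spacing errors of the CAVs. -/
abbrev OutIdx {n : ℕ} (S : Finset (Fin n)) : Type := Fin n ⊕ S

/-! ### The continuous-time linearized model `ẋ = A x + B u + H ε`, `y = C x` -/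

/-- Diagonal block of an HDV. -/
def blockP1 (α₁ α₂ : ℝ) : Matrix (Fin 2) (Fin 2) ℝ := !![0, -1; α₁, -α₂]

/-- Subdiagonal block of an HDV. -/
def blockP2 (α₃ : ℝ) : Matrix (Fin 2) (Fin 2) ℝ := !![0, 1; 0, α₃]

/-- Diagonal block of a CAV. -/
def blockS1 : Matrix (Fin 2) (Fin 2) ℝ := !![0, -1; 0, 0]

/-- Subdiagonal block of a CAV. -/
def blockS2 : Matrix (Fin 2) (Fin 2) ℝ := !![0, 1; 0, 0]

/-- The block lower-bidiagonal system matrix; `S` is the set of CAVs. -/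
def matA {n : ℕ} (S : Finset (Fin n)) (α₁ α₂ α₃ : ℝ) : Matrix (StateIdx n) (StateIdx n) ℝ :=
  Matrix.of fun p q =>
    if q.1 = p.1 then (if p.1 ∈ S then blockS1 else blockP1 α₁ α₂) p.2 q.2
    else if (q.1 : ℕ) + 1 = (p.1 : ℕ) then (if p.1 ∈ S then blockS2 else blockP2 α₃) p.2 q.2
    else 0

/-- The control input of CAV `i` is its acceleration. -/
def matB {n : ℕ} (S : Finset (Fin n)) : Matrix (StateIdx n) S ℝ :=
  Matrix.of fun p i => if p = ((i : Fin n), (1 : Fin 2)) then 1 else 0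

/-- The column `H = (1, η, 0, …, 0)ᵀ` through which the velocity error of the head vehicle enters
the dynamics of the first following vehicle. -/
def matH (n : ℕ) (η : ℝ) : Matrix (StateIdx n) (Fin 1) ℝ :=
  Matrix.of fun p _ => if (p.1 : ℕ) = 0 then (![1, η] : Fin 2 → ℝ) p.2 else 0

/-- The output matrix. -/
def matC {n : ℕ} (S : Finset (Fin n)) : Matrix (OutIdx S) (StateIdx n) ℝ :=
  Matrix.of fun o q =>
    Sum.elim (fun i : Fin n => if q = (i, (1 : Fin 2)) then 1 else 0)
      (fun i : S => if q = ((i : Fin n), (0 : Fin 2)) then 1 else 0) o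

/-! ### Discretization with sampling time `Δt` -/

/-- `e^{A Δt}`. -/
def discState {ι : Type} [Fintype ι] [DecidableEq ι] (A : Matrix ι ι ℝ) (Δt : ℝ) :
    Matrix ι ι ℝ :=
  NormedSpace.exp (Δt • A)

/-- `∫₀^{Δt} e^{A t} B dt`, entrywise. -/
def discInput {ι κ : Type} [Fintype ι] [DecidableEq ι] (A : Matrix ι ι ℝ) (B : Matrix ι κ ℝ)
    (Δt : ℝ) : Matrix ι κ ℝ :=
  Matrix.of fun i j => ∫ t in (0 : ℝ)..Δt, (NormedSpace.exp (t • A) * B) i j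

/-- The sampling-time assumption: complex eigenvalues of `A` with the same real part do not have
imaginary parts that differ by a nonzero integer multiple of `2π / Δt`. -/
def SamplingCondition {ι : Type} [Fintype ι] [DecidableEq ι] (A : Matrix ι ι ℝ) (Δt : ℝ) :
    Prop :=
  ∀ z ∈ spectrum ℂ (A.map (algebraMap ℝ ℂ)), ∀ w ∈ spectrum ℂ (A.map (algebraMap ℝ ℂ)),
    (z - w).re = 0 → ∀ k : ℕ, 1 ≤ k → |(z - w).im| ≠ 2 * Real.pi * k / Δt

/-- `(u, ε, y)` is a length-`L` trajectory of
`x(k+1) = A x(k) + B u(k) + H ε(k)`, `y(k) = C x(k)`, for some state sequence `x`. -/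
def IsTrajectory {ι κ τ o : Type} [Fintype ι] [Fintype κ] [Fintype τ]
    (A : Matrix ι ι ℝ) (B : Matrix ι κ ℝ) (H : Matrix ι τ ℝ) (C : Matrix o ι ℝ) {L : ℕ}
    (u : Fin L → κ → ℝ) (ε : Fin L → τ → ℝ) (y : Fin L → o → ℝ) : Prop :=
  ∃ x : ℕ → ι → ℝ, ∀ k : Fin L,
    x (k + 1) = A *ᵥ x k + B *ᵥ u k + H *ᵥ ε k ∧ y k = C *ᵥ x k

/-- Length-`L` trajectories of the discretized mixed traffic system. -/
def IsTrafficTrajectory {n : ℕ} (S : Finset (Fin n)) (α₁ α₂ α₃ η Δt : ℝ) {L : ℕ}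
    (u : Fin L → S → ℝ) (ε : Fin L → Fin 1 → ℝ) (y : Fin L → OutIdx S → ℝ) : Prop :=
  IsTrajectory (discState (matA S α₁ α₂ α₃) Δt)
    (discInput (matA S α₁ α₂ α₃) (matB S) Δt)
    (discInput (matA S α₁ α₂ α₃) (matH n η) Δt) (matC S) u ε y

/-! ### Hankel matrices -/

/-- `col(w(1), …, w(L))`. -/
def col {L : ℕ} {κ : Type} (w : Fin L → κ → ℝ) : Fin L × κ → ℝ := fun p => w p.1 p.2

/-- Hankel matrix of order `L` of a signal of length `T`: it has `L` block rows and, for `L ≤ T`,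
`T - L + 1` columns. -/
def hankel {T : ℕ} {κ : Type} (L : ℕ) (w : Fin T → κ → ℝ) :
    Matrix (Fin L × κ) (Fin (T + 1 - L)) ℝ :=
  Matrix.of fun p j => w ⟨p.1 + j, by have := p.1.2; have := j.2; omega⟩ p.2

/-- Persistent excitation of order `l`: `l ≤ T` and the Hankel matrix has full row rank. -/
def PersistentlyExciting {T : ℕ} {κ : Type} [Fintype κ] (l : ℕ) (w : Fin T → κ → ℝ) : Prop :=
  l ≤ T ∧ (hankel l w).rank = Fintype.card (Fin l × κ)

/-- The combined input `û(k) = col(ε(k), u(k))`. -/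
def combinedInput {T : ℕ} {κ : Type} (u : Fin T → κ → ℝ) (ε : Fin T → Fin 1 → ℝ) :
    Fin T → Fin 1 ⊕ κ → ℝ :=
  fun k => Sum.elim (ε k) (u k)

/-- The first `Tini` block rows of the Hankel matrix of order `Tini + N` (past data). -/
def hankelPast {T : ℕ} {κ : Type} (Tini N : ℕ) (w : Fin T → κ → ℝ) :
    Matrix (Fin Tini × κ) (Fin (T + 1 - (Tini + N))) ℝ :=
  (hankel (Tini + N) w).submatrix (fun p => (Fin.castAdd N p.1, p.2)) id

/-- The last `N` block rows of the Hankel matrix of order `Tini + N` (future data). -/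
def hankelFuture {T : ℕ} {κ : Type} (Tini N : ℕ) (w : Fin T → κ → ℝ) :
    Matrix (Fin N × κ) (Fin (T + 1 - (Tini + N))) ℝ :=
  (hankel (Tini + N) w).submatrix (fun p => (Fin.natAdd Tini p.1, p.2)) id

/-- `col(u_ini, ε_ini, y_ini, u, ε, y)` is in the range of the stacked data matrix
`col(U_p, E_p, Y_p, U_f, E_f, Y_f)`. -/
def InDataRange {T Tini N : ℕ} {κ o : Type}
    (ud : Fin T → κ → ℝ) (εd : Fin T → Fin 1 → ℝ) (yd : Fin T → o → ℝ)
    (uini : Fin Tini → κ → ℝ) (εini : Fin Tini → Fin 1 → ℝ) (yini : Fin Tini → o → ℝ)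
    (u : Fin N → κ → ℝ) (ε : Fin N → Fin 1 → ℝ) (y : Fin N → o → ℝ) : Prop :=
  ∃ g : Fin (T + 1 - (Tini + N)) → ℝ,
    hankelPast Tini N ud *ᵥ g = col uini ∧
    hankelPast Tini N εd *ᵥ g = col εini ∧
    hankelPast Tini N yd *ᵥ g = col yini ∧
    hankelFuture Tini N ud *ᵥ g = col u ∧
    hankelFuture Tini N εd *ᵥ g = col ε ∧
    hankelFuture Tini N yd *ᵥ g = col y

end MixedTraffic

end

/-!
Fix a window of length `L = Tini + N`. For a controllable system under persistently exciting inputs,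
the matrix stacking the first states of all data windows on the Hankel matrix of the inputs has full
row rank: a linear relation between its rows can be shifted in time along the dynamics, and by
Cayley–Hamilton a combination of its shifts involves the inputs only, hence vanishes by excitation;
controllability recovers the relation from its shifts. So every initial state and input sequence is
a combination of data windows, and the outputs follow by linearity.

Controllability of the sampled system reduces to the Hautus condition in continuous time: the
sampling condition makes `l ↦ e^{lΔt}` injective on the spectrum of `A`, so left eigenvectors of
`e^{AΔt}` are left eigenvectors of `A`. For such a covector, with spacing and velocity components
`s` and `w`, the quantity `s + α₃ w` vanishes at the first vehicle, and this propagates along the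
platoon unless `l α₃ = -α₁`, the case covered by `α₁ - α₂ α₃ + α₃² ≠ 0`.

For `Tini` at least the dimension of the state space, two state sequences with the same inputs
and the same past outputs have the same outputs forever, again by Cayley–Hamilton.
-/

namespace MixedTraffic

section Controllability

variable {ι κ o K : Type*} [Fintype ι] [DecidableEq ι]

theorem pow_mem_span_pow_lt_card [CommRing K] (A : Matrix ι ι K) (k : ℕ) :
    A ^ k ∈ Submodule.span K ((A ^ ·) '' Set.Iio (Fintype.card ι)) := by
  nontriviality K
  rw [A.pow_eq_aeval_mod_charpoly, Polynomial.aeval_eq_sum_range]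
  refine Submodule.sum_mem _ fun i _ => ?_
  rcases lt_or_ge i (Fintype.card ι) with hi | hi
  · exact Submodule.smul_mem _ _ (Submodule.subset_span ⟨i, hi, rfl⟩)
  · have hdeg := Polynomial.degree_modByMonic_lt (Polynomial.X ^ k) A.charpoly_monic
    rw [A.charpoly_degree_eq_dim] at hdeg
    rw [Polynomial.coeff_eq_zero_of_degree_lt (hdeg.trans_le (by exact_mod_cast hi)), zero_smul]
    exact Submodule.zero_mem _

theorem map_pow_eq_zero_of_lt_card [CommRing K] {M : Type*} [AddCommGroup M] [Module K M]
    (A : Matrix ι ι K) (F : Matrix ι ι K →ₗ[K] M) (h : ∀ k < Fintype.card ι, F (A ^ k) = 0)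
    (k : ℕ) : F (A ^ k) = 0 := by
  have hspan : Submodule.span K ((A ^ ·) '' Set.Iio (Fintype.card ι)) ≤ LinearMap.ker F :=
    Submodule.span_le.2 (Set.forall_mem_image.2 h)
  exact hspan (pow_mem_span_pow_lt_card A k)

theorem mulVec_pow_mulVec_eq_zero_of_lt_card [CommRing K] (A : Matrix ι ι K) (C : Matrix o ι K)
    (x : ι → K) (h : ∀ k < Fintype.card ι, C *ᵥ A ^ k *ᵥ x = 0) (k : ℕ) :
    C *ᵥ A ^ k *ᵥ x = 0 :=
  map_pow_eq_zero_of_lt_card A (C.mulVecLin ∘ₗ (Matrix.mulVecBilin K K).flip x) h k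

theorem vecMul_pow_vecMul_eq_zero_of_lt_card [CommRing K] (A : Matrix ι ι K) (G : Matrix ι κ K)
    (ξ : ι → K) (h : ∀ k < Fintype.card ι, ξ ᵥ* A ^ k ᵥ* G = 0) (k : ℕ) :
    ξ ᵥ* A ^ k ᵥ* G = 0 :=
  map_pow_eq_zero_of_lt_card A (G.vecMulLinear ∘ₗ Matrix.vecMulBilin K K ξ) h k

/-- Controllability of the pair `(A, G)`, in dual form: no nonzero covector annihilates all the
blocks `A ^ k * G` of the Kalman matrix. Powers beyond `card ι - 1` are redundant by
Cayley–Hamilton, but including them spares the bound. -/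
def IsControllable [Field K] (A : Matrix ι ι K) (G : Matrix ι κ K) : Prop :=
  ∀ ξ : ι → K, (∀ k : ℕ, ξ ᵥ* A ^ k ᵥ* G = 0) → ξ = 0

end Controllability

theorem eq_zero_of_backward_recurrence {R M : Type*} [Semiring R] [AddCommMonoid M] [Module R M]
    {d N : ℕ} {c : ℕ → R} (hc : c d = 1) {w : ℕ → M} (hw : ∀ m, N ≤ m → w m = 0)
    (hrec : ∀ m, ∑ i ∈ Finset.range (d + 1), c i • w (m + (d - i)) = 0) (m : ℕ) : w m = 0 := by
  suffices H : ∀ s m, N ≤ m + s → w m = 0 from H N m (Nat.le_add_left N m)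
  intro s
  induction s with
  | zero => exact hw
  | succ s ih =>
    intro m hm
    have hlater : ∀ i ∈ Finset.range d, c i • w (m + (d - i)) = 0 := fun i hi => by
      rw [ih _ (by have := Finset.mem_range.1 hi; omega), smul_zero]
    simpa [Finset.sum_range_succ, Finset.sum_eq_zero hlater, hc] using hrec m

/-- The linear relation `ξ · x(j) + ∑ₐ θ(a) · w(j + a) = 0`, encoded by its coefficients `(ξ, θ)`,
between the state `x` at an unspecified time `j` and the inputs `w` from that time on. -/
abbrev WindowRelation (ι κ K : Type*) : Type _ := (ι → K) × (ℕ → κ → K)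

namespace WindowRelation

variable {ι κ K : Type*} [Fintype ι]

/-- Pull a relation back by one time step along `x(j + 1) = A x(j) + G w(j)`: the relation that
holds at time `j` if and only if the given one holds at time `j + 1`. -/
def shift [CommRing K] (A : Matrix ι ι K) (G : Matrix ι κ K) :
    Module.End K (WindowRelation ι κ K) where
  toFun r := (r.1 ᵥ* A, fun | 0 => r.1 ᵥ* G | a + 1 => r.2 a)
  map_add' r s := by
    refine Prod.ext (Matrix.add_vecMul A r.1 s.1) (funext fun a => ?_)
    cases a with
    | zero => exact Matrix.add_vecMul G r.1 s.1
    | succ a => rfl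
  map_smul' c r := by
    refine Prod.ext (Matrix.smul_vecMul c r.1 A) (funext fun a => ?_)
    cases a with
    | zero => exact Matrix.smul_vecMul c r.1 G
    | succ a => rfl

/-- The left-hand side `ξ · x(j) + ∑_{a < L} θ(a) · w(j + a)` of a relation at time `j`, over a
window of length `L`. -/
def eval [CommRing K] [Fintype κ] (x : ℕ → ι → K) (w : ℕ → κ → K) (L j : ℕ) :
    WindowRelation ι κ K →ₗ[K] K where
  toFun r := r.1 ⬝ᵥ x j + ∑ a ∈ Finset.range L, r.2 a ⬝ᵥ w (j + a)
  map_add' r s := by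
    simp only [Prod.fst_add, Prod.snd_add, Pi.add_apply, add_dotProduct, Finset.sum_add_distrib]
    ring
  map_smul' c r := by
    simp only [Prod.smul_fst, Prod.smul_snd, Pi.smul_apply, smul_dotProduct, ← Finset.smul_sum,
      ← smul_add, RingHom.id_apply]

section Eval

variable [CommRing K] [Fintype κ] {A : Matrix ι ι K} {G : Matrix ι κ K} {x : ℕ → ι → K}
  {w : ℕ → κ → K}

theorem eval_shift {j : ℕ} (hx : x (j + 1) = A *ᵥ x j + G *ᵥ w j) (L : ℕ)
    (r : WindowRelation ι κ K) : eval x w (L + 1) j (shift A G r) = eval x w L (j + 1) r := by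
  simp only [eval, shift, LinearMap.coe_mk, AddHom.coe_mk, Finset.sum_range_succ', hx,
    dotProduct_add, Matrix.dotProduct_mulVec, add_zero, Nat.add_right_comm j, ← add_assoc]
  ring

theorem eval_shift_pow {T : ℕ} (hx : ∀ k < T, x (k + 1) = A *ᵥ x k + G *ᵥ w k)
    (r : WindowRelation ι κ K) (i : ℕ) {L j : ℕ} (hj : j + i ≤ T) :
    eval x w (L + i) j ((shift A G ^ i) r) = eval x w L (j + i) r := by
  induction i generalizing j with
  | zero => rfl
  | succ i ih =>
    rw [pow_succ', Module.End.mul_apply, ← add_assoc, eval_shift (hx j (by omega)), ih (by omega),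
      Nat.add_right_comm, add_assoc]

theorem eval_eq_of_le (j : ℕ) {L L' : ℕ} (hL : L ≤ L') {r : WindowRelation ι κ K}
    (hr : ∀ a, L ≤ a → r.2 a = 0) : eval x w L' j r = eval x w L j r := by
  refine congrArg (r.1 ⬝ᵥ x j + ·) (Finset.sum_subset (Finset.range_mono hL) fun a _ ha => ?_).symm
  rw [hr a (by simpa using ha), zero_dotProduct]

end Eval

section ShiftPow

variable [CommRing K] (A : Matrix ι ι K) (G : Matrix ι κ K) (r : WindowRelation ι κ K)

theorem shift_pow_snd_add (i a : ℕ) : ((shift A G ^ i) r).2 (a + i) = r.2 a := by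
  induction i with
  | zero => rfl
  | succ i ih =>
    rw [pow_succ', Module.End.mul_apply, ← ih]
    rfl

theorem shift_pow_snd_eq_zero {L : ℕ} (hr : ∀ a, L ≤ a → r.2 a = 0) {i a : ℕ} (ha : L + i ≤ a) :
    ((shift A G ^ i) r).2 a = 0 := by
  obtain ⟨b, rfl⟩ := Nat.exists_eq_add_of_le' (show i ≤ a by omega)
  rw [shift_pow_snd_add, hr b (by omega)]

variable [DecidableEq ι]

theorem shift_pow_fst (i : ℕ) : ((shift A G ^ i) r).1 = r.1 ᵥ* A ^ i := by
  induction i with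
  | zero => simp
  | succ i ih =>
    rw [pow_succ', Module.End.mul_apply, pow_succ, ← Matrix.vecMul_vecMul, ← ih]
    rfl

theorem shift_pow_succ_snd_zero (i : ℕ) :
    ((shift A G ^ (i + 1)) r).2 0 = r.1 ᵥ* A ^ i ᵥ* G := by
  rw [pow_succ', Module.End.mul_apply, ← shift_pow_fst A G]
  rfl

theorem aeval_charpoly_shift : Polynomial.aeval (shift A G) A.charpoly r =
    ∑ i ∈ Finset.range (Fintype.card ι + 1), A.charpoly.coeff i • (shift A G ^ i) r := by
  cases subsingleton_or_nontrivial K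
  · exact (Module.subsingleton K (WindowRelation ι κ K)).elim _ _
  · simp only [Polynomial.aeval_eq_sum_range, A.charpoly_natDegree_eq_dim, LinearMap.sum_apply,
      LinearMap.smul_apply]

theorem aeval_charpoly_shift_fst :
    (Polynomial.aeval (shift A G) A.charpoly r).1 = 0 := by
  have hCH : r.1 ᵥ* Polynomial.aeval A A.charpoly = 0 := by
    rw [A.aeval_self_charpoly, Matrix.vecMul_zero]
  rw [← hCH]
  simp only [Polynomial.aeval_eq_sum_range, LinearMap.sum_apply, LinearMap.smul_apply, Prod.fst_sum,
    Prod.smul_fst, shift_pow_fst, Matrix.vecMul_sum, Matrix.vecMul_smul]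

end ShiftPow

theorem eq_zero_of_aeval_charpoly_shift_eq_zero [Field K] [DecidableEq ι] {A : Matrix ι ι K}
    {G : Matrix ι κ K} (hctrl : IsControllable A G) {L : ℕ} {r : WindowRelation ι κ K}
    (hr : ∀ a, L ≤ a → r.2 a = 0) (h : Polynomial.aeval (shift A G) A.charpoly r = 0) :
    r = 0 := by
  set d := Fintype.card ι with hd
  have hshift : ∀ i ≤ d, ∀ a, ((shift A G ^ i) r).2 a = ((shift A G ^ d) r).2 (a + (d - i)) :=
    fun i hi a => by
      rw [← shift_pow_snd_add A G _ (d - i) a, ← Module.End.mul_apply, ← pow_add,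
        Nat.sub_add_cancel hi]
  have hzero : ∀ a, ((shift A G ^ d) r).2 a = 0 := by
    refine eq_zero_of_backward_recurrence (d := d) (N := L + d) (c := A.charpoly.coeff) ?_ ?_ ?_
    · rw [hd, ← A.charpoly_natDegree_eq_dim]
      exact A.charpoly_monic
    · exact fun a ha => shift_pow_snd_eq_zero A G r hr ha
    · intro a
      have ha := congrArg (fun s : WindowRelation ι κ K => s.2 a) h
      simp only [aeval_charpoly_shift, Prod.snd_sum, Finset.sum_apply, Prod.smul_snd, Pi.smul_apply,
        Prod.snd_zero, Pi.zero_apply] at ha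
      rw [← ha]
      exact Finset.sum_congr rfl fun i hi => by
        rw [hshift i (by have := Finset.mem_range.1 hi; omega)]
  refine Prod.ext (hctrl _ (vecMul_pow_vecMul_eq_zero_of_lt_card _ _ _ fun k hk => ?_))
    (funext fun a => ?_)
  · rw [← shift_pow_succ_snd_zero, hshift (k + 1) hk, hzero]
  · rw [← shift_pow_snd_add A G r d a, hzero]
    rfl

theorem eq_zero_of_eval_eq_zero [Field K] [DecidableEq ι] [Fintype κ] {A : Matrix ι ι K}
    {G : Matrix ι κ K} (hctrl : IsControllable A G) {T L : ℕ} {x : ℕ → ι → K} {w : ℕ → κ → K}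
    (hx : ∀ k < T, x (k + 1) = A *ᵥ x k + G *ᵥ w k)
    (hexc : ∀ θ : ℕ → κ → K,
      (∀ j, j + (L + Fintype.card ι) ≤ T →
        ∑ a ∈ Finset.range (L + Fintype.card ι), θ a ⬝ᵥ w (j + a) = 0) →
      ∀ a < L + Fintype.card ι, θ a = 0)
    {r : WindowRelation ι κ K} (hr : ∀ a, L ≤ a → r.2 a = 0)
    (heval : ∀ j, j + L ≤ T → eval x w L j r = 0) : r = 0 := by
  -- By Cayley–Hamilton this combination of shifts involves the inputs only, hence is excluded by
  -- excitation.
  set s := Polynomial.aeval (shift A G) A.charpoly r with hs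
  rw [aeval_charpoly_shift] at hs
  have hs_eval : ∀ j, j + (L + Fintype.card ι) ≤ T → eval x w (L + Fintype.card ι) j s = 0 := by
    intro j hj
    rw [hs, map_sum]
    refine Finset.sum_eq_zero fun i hi => ?_
    have hi' : i ≤ Fintype.card ι := Nat.lt_succ_iff.1 (Finset.mem_range.1 hi)
    rw [map_smul, eval_eq_of_le j (Nat.add_le_add_left hi' L)
      fun _ => shift_pow_snd_eq_zero A G r hr, eval_shift_pow hx r i (by omega),
      heval _ (by omega), smul_zero]
  have hs_fst : s.1 = 0 := aeval_charpoly_shift_fst A G r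
  have hs_snd : ∀ a < L + Fintype.card ι, s.2 a = 0 :=
    hexc s.2 fun j hj => by simpa [eval, hs_fst] using hs_eval j hj
  refine eq_zero_of_aeval_charpoly_shift_eq_zero hctrl hr (Prod.ext hs_fst (funext fun a => ?_))
  rcases lt_or_ge a (L + Fintype.card ι) with ha | ha
  · exact hs_snd a ha
  · change s.2 a = 0
    rw [hs, Prod.snd_sum, Finset.sum_apply]
    refine Finset.sum_eq_zero fun i hi => ?_
    have hi' : L + i ≤ a := by have := Finset.mem_range.1 hi; omega
    rw [Prod.smul_snd, Pi.smul_apply, shift_pow_snd_eq_zero A G r hr hi', smul_zero]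

end WindowRelation

section RowRank

variable {m n K : Type*} [Fintype m] [Fintype n] [Field K] {M : Matrix m n K}

theorem vecMul_injective_iff_rank_eq_card :
    Function.Injective M.vecMul ↔ M.rank = Fintype.card m := by
  rw [Matrix.vecMul_injective_iff, linearIndependent_iff_card_eq_finrank_span,
    Matrix.rank_eq_finrank_span_row, Set.finrank, eq_comm]

theorem mulVec_surjective_of_vecMul_injective (hM : Function.Injective M.vecMul) :
    Function.Surjective M.mulVec := by
  have hrange : LinearMap.range M.mulVecLin = ⊤ := Submodule.eq_top_of_finrank_eq <| by
    rw [Module.finrank_fintype_fun_eq_card]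
    exact vecMul_injective_iff_rank_eq_card.1 hM
  exact LinearMap.range_eq_top.1 hrange

end RowRank

section Hankel

variable {T L : ℕ} {ι κ : Type}

theorem hankel_apply (w : ℕ → κ → ℝ) (p : Fin L × κ) (j : Fin (T + 1 - L)) :
    hankel L (fun k : Fin T => w k) p j = w (j + p.1) p.2 := by
  simp only [hankel, Matrix.of_apply, Nat.add_comm]

/-- The combination `k ↦ ∑ⱼ g(j) x(j + k)` of the time shifts of a signal: the product of a Hankel
matrix with the coefficient vector `g`, for a window of unspecified length. -/
def windowComb {m : ℕ} (g : Fin m → ℝ) (x : ℕ → ι → ℝ) (k : ℕ) : ι → ℝ :=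
  ∑ j, g j • x (j + k)

theorem hankel_mulVec_eq_col_iff {w : ℕ → κ → ℝ} {g : Fin (T + 1 - L) → ℝ} {v : Fin L → κ → ℝ} :
    hankel L (fun k : Fin T => w k) *ᵥ g = col v ↔ ∀ a : Fin L, windowComb g w a = v a := by
  simp only [funext_iff, Prod.forall, col, windowComb, Matrix.mulVec, dotProduct, hankel_apply,
    Finset.sum_apply, Pi.smul_apply, smul_eq_mul, mul_comm]

theorem col_vecMul_hankel [Fintype κ] (θ w : ℕ → κ → ℝ) (j : Fin (T + 1 - L)) :
    (col (fun a : Fin L => θ a) ᵥ* hankel L (fun k : Fin T => w k)) j =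
      ∑ a ∈ Finset.range L, θ a ⬝ᵥ w (j + a) := by
  simp only [Matrix.vecMul, dotProduct, Fintype.sum_prod_type, col, hankel_apply, Finset.sum_range]

theorem exists_col_eq (ψ : Fin L × κ → ℝ) :
    ∃ θ : ℕ → κ → ℝ, (∀ a, L ≤ a → θ a = 0) ∧ col (fun a : Fin L => θ a) = ψ :=
  ⟨fun a c => if h : a < L then ψ (⟨a, h⟩, c) else 0,
    fun _ ha => funext fun _ => dif_neg ha.not_gt, funext fun p => dif_pos p.1.2⟩

theorem PersistentlyExciting.eq_zero [Fintype κ] {w : ℕ → κ → ℝ}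
    (hexc : PersistentlyExciting L fun k : Fin T => w k) (θ : ℕ → κ → ℝ)
    (hθ : ∀ j, j + L ≤ T → ∑ a ∈ Finset.range L, θ a ⬝ᵥ w (j + a) = 0) (a : ℕ) (ha : a < L) :
    θ a = 0 := by
  have hker : col (fun a : Fin L => θ a) ᵥ* hankel L (fun k : Fin T => w k) = 0 :=
    funext fun j => by
      rw [col_vecMul_hankel, hθ j (by have := hexc.1; omega), Pi.zero_apply]
  have hcol := vecMul_injective_iff_rank_eq_card.2 hexc.2 (hker.trans (Matrix.zero_vecMul _).symm)
  exact funext fun c => congrFun hcol (⟨a, ha⟩, c)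

section WindowComb

variable [Fintype ι] [Fintype κ] {A : Matrix ι ι ℝ} {G : Matrix ι κ ℝ} {x : ℕ → ι → ℝ}
  {w : ℕ → κ → ℝ}

theorem mulVec_windowComb {o : Type} {m : ℕ} (C : Matrix o ι ℝ) (g : Fin m → ℝ) (x : ℕ → ι → ℝ)
    (k : ℕ) : C *ᵥ windowComb g x k = windowComb g (fun k => C *ᵥ x k) k := by
  simp only [windowComb, Matrix.mulVec_sum, Matrix.mulVec_smul]

theorem windowComb_succ (hx : ∀ k < T, x (k + 1) = A *ᵥ x k + G *ᵥ w k)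
    (g : Fin (T + 1 - L) → ℝ) {k : ℕ} (hk : k < L) :
    windowComb g x (k + 1) = A *ᵥ windowComb g x k + G *ᵥ windowComb g w k := by
  rw [mulVec_windowComb, mulVec_windowComb]
  simp only [windowComb, ← Finset.sum_add_distrib, ← smul_add]
  refine Finset.sum_congr rfl fun j _ => ?_
  rw [← add_assoc, hx _ (by have := j.2; omega)]

theorem eq_windowComb_of_recurrence (hx : ∀ k < T, x (k + 1) = A *ᵥ x k + G *ᵥ w k)
    {g : Fin (T + 1 - L) → ℝ} {z : ℕ → ι → ℝ} {v : Fin L → κ → ℝ} (hg₀ : windowComb g x 0 = z 0)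
    (hgw : ∀ k : Fin L, windowComb g w k = v k)
    (hz : ∀ k : Fin L, z (k + 1) = A *ᵥ z k + G *ᵥ v k) {k : ℕ} (hk : k ≤ L) :
    windowComb g x k = z k := by
  induction k with
  | zero => exact hg₀
  | succ k ih => rw [windowComb_succ hx g hk, ih (by omega), hgw ⟨k, hk⟩, hz ⟨k, hk⟩]

/-- The data matrix of the fundamental lemma: the first states of all windows of length `L`, above
the Hankel matrix of the inputs. -/
def stateInputHankel (L : ℕ) (x : ℕ → ι → ℝ) (w : Fin T → κ → ℝ) :
    Matrix (ι ⊕ Fin L × κ) (Fin (T + 1 - L)) ℝ :=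
  Matrix.fromRows (Matrix.of fun i j => x j i) (hankel L w)

theorem stateInputHankel_vecMul_injective [DecidableEq ι] (hctrl : IsControllable A G)
    (hx : ∀ k < T, x (k + 1) = A *ᵥ x k + G *ᵥ w k)
    (hexc : PersistentlyExciting (L + Fintype.card ι) fun k : Fin T => w k) :
    Function.Injective (stateInputHankel L x fun k : Fin T => w k).vecMul := by
  refine (injective_iff_map_eq_zero (Matrix.vecMulLinear _)).2 fun v hv => ?_
  obtain ⟨θ, hθ, hθv⟩ := exists_col_eq (v ∘ Sum.inr)
  have heval : ∀ j, j + L ≤ T → WindowRelation.eval x w L j (v ∘ Sum.inl, θ) = 0 := by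
    intro j hj
    have hv_j := congrFun hv ⟨j, by omega⟩
    rw [Matrix.vecMulLinear_apply, stateInputHankel, Matrix.vecMul_fromRows, ← hθv, Pi.add_apply,
      col_vecMul_hankel] at hv_j
    exact hv_j
  have hzero := WindowRelation.eq_zero_of_eval_eq_zero hctrl hx hexc.eq_zero hθ heval
  obtain ⟨hv_inl, rfl⟩ := Prod.ext_iff.1 hzero
  exact funext <| Sum.rec (congrFun hv_inl) (congrFun hθv.symm)

theorem exists_windowComb_eq [DecidableEq ι] (hctrl : IsControllable A G)
    (hx : ∀ k < T, x (k + 1) = A *ᵥ x k + G *ᵥ w k)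
    (hexc : PersistentlyExciting (L + Fintype.card ι) fun k : Fin T => w k) (x₀ : ι → ℝ)
    (v : Fin L → κ → ℝ) : ∃ g : Fin (T + 1 - L) → ℝ,
      windowComb g x 0 = x₀ ∧ ∀ a : Fin L, windowComb g w a = v a := by
  obtain ⟨g, hg⟩ := mulVec_surjective_of_vecMul_injective
    (stateInputHankel_vecMul_injective hctrl hx hexc) (Sum.elim x₀ (col v))
  rw [stateInputHankel, Matrix.fromRows_mulVec] at hg
  obtain ⟨hgx, hgw⟩ := Sum.elim_eq_iff.1 hg
  refine ⟨g, ?_, hankel_mulVec_eq_col_iff.1 hgw⟩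
  rw [← hgx]
  ext i
  simp [windowComb, Matrix.mulVec, dotProduct, mul_comm]

end WindowComb

end Hankel

/-- `(w, y)` is a length-`L` trajectory of `x(k+1) = A x(k) + G w(k)`, `y(k) = C x(k)`: the notion
`IsTrajectory` for a system with all its inputs collected in a single signal. -/
def IsLTITrajectory {ι κ o : Type} [Fintype ι] [Fintype κ] (A : Matrix ι ι ℝ) (G : Matrix ι κ ℝ)
    (C : Matrix o ι ℝ) {L : ℕ} (w : Fin L → κ → ℝ) (y : Fin L → o → ℝ) : Prop :=
  ∃ x : ℕ → ι → ℝ, ∀ k : Fin L, x (k + 1) = A *ᵥ x k + G *ᵥ w k ∧ y k = C *ᵥ x k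

namespace IsLTITrajectory

variable {ι κ o : Type} [Fintype ι] [Fintype κ] {A : Matrix ι ι ℝ} {G : Matrix ι κ ℝ}
  {C : Matrix o ι ℝ} {T L : ℕ} {wd : Fin T → κ → ℝ} {yd : Fin T → o → ℝ}

theorem exists_extension (hdata : IsLTITrajectory A G C wd yd) :
    ∃ (x : ℕ → ι → ℝ) (w : ℕ → κ → ℝ), (∀ k < T, x (k + 1) = A *ᵥ x k + G *ᵥ w k) ∧
      (wd = fun k : Fin T => w k) ∧ yd = fun k : Fin T => C *ᵥ x k := by
  obtain ⟨x, hx⟩ := hdata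
  obtain ⟨w, rfl⟩ := Fin.val_injective.surjective_comp_right wd
  exact ⟨x, w, fun k hk => (hx ⟨k, hk⟩).1, rfl, funext fun k => (hx k).2⟩

theorem of_hankel (hdata : IsLTITrajectory A G C wd yd) {g : Fin (T + 1 - L) → ℝ}
    {w : Fin L → κ → ℝ} {y : Fin L → o → ℝ} (hgw : hankel L wd *ᵥ g = col w)
    (hgy : hankel L yd *ᵥ g = col y) : IsLTITrajectory A G C w y := by
  obtain ⟨x, v, hx, rfl, rfl⟩ := hdata.exists_extension
  rw [hankel_mulVec_eq_col_iff] at hgw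
  rw [hankel_mulVec_eq_col_iff (w := fun k => C *ᵥ x k)] at hgy
  refine ⟨windowComb g x, fun k => ⟨?_, ?_⟩⟩
  · rw [windowComb_succ hx g k.2, hgw]
  · rw [← hgy, mulVec_windowComb]

/-- **Willems' fundamental lemma**. -/
theorem iff_exists_hankel [DecidableEq ι] (hctrl : IsControllable A G)
    (hdata : IsLTITrajectory A G C wd yd) (hexc : PersistentlyExciting (L + Fintype.card ι) wd)
    {w : Fin L → κ → ℝ} {y : Fin L → o → ℝ} :
    IsLTITrajectory A G C w y ↔
      ∃ g : Fin (T + 1 - L) → ℝ, hankel L wd *ᵥ g = col w ∧ hankel L yd *ᵥ g = col y := by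
  refine ⟨fun ⟨z, hz⟩ => ?_, fun ⟨g, hgw, hgy⟩ => hdata.of_hankel hgw hgy⟩
  obtain ⟨x, v, hx, rfl, rfl⟩ := hdata.exists_extension
  obtain ⟨g, hg₀, hgw⟩ := exists_windowComb_eq hctrl hx hexc (z 0) w
  refine ⟨g, hankel_mulVec_eq_col_iff.2 hgw,
    (hankel_mulVec_eq_col_iff (w := fun k => C *ᵥ x k)).2 fun a => ?_⟩
  rw [(hz a).2, ← mulVec_windowComb,
    eq_windowComb_of_recurrence hx hg₀ hgw (fun k => (hz k).1) a.2.le]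

theorem output_unique {w : Fin L → κ → ℝ} {y y' : Fin L → o → ℝ}
    (h : IsLTITrajectory A G C w y) (h' : IsLTITrajectory A G C w y') (hL : Fintype.card ι ≤ L)
    (hpast : ∀ k : Fin L, (k : ℕ) < Fintype.card ι → y k = y' k) : y = y' := by
  classical
  obtain ⟨x, hx⟩ := h
  obtain ⟨x', hx'⟩ := h'
  have hdiff : ∀ k ≤ L, x k - x' k = A ^ k *ᵥ (x 0 - x' 0) := by
    intro k
    induction k with
    | zero => simp
    | succ k ih =>
      intro hk
      rw [pow_succ', ← Matrix.mulVec_mulVec, ← ih (by omega), (hx ⟨k, hk⟩).1, (hx' ⟨k, hk⟩).1,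
        Matrix.mulVec_sub]
      abel
  have houtput : ∀ k : Fin L, y k - y' k = C *ᵥ A ^ (k : ℕ) *ᵥ (x 0 - x' 0) := fun k => by
    rw [(hx k).2, (hx' k).2, ← hdiff k k.2.le, Matrix.mulVec_sub]
  have hzero := mulVec_pow_mulVec_eq_zero_of_lt_card A C (x 0 - x' 0) fun k hk => by
    rw [← houtput ⟨k, hk.trans_le hL⟩, hpast _ hk, sub_self]
  exact funext fun k => sub_eq_zero.1 ((houtput k).trans (hzero k))

end IsLTITrajectory

section DataRange

variable {T L Tini N : ℕ} {κ o : Type}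

theorem isTrajectory_iff_isLTITrajectory {ι : Type} [Fintype ι] [Fintype κ] {A : Matrix ι ι ℝ}
    {B : Matrix ι κ ℝ} {H : Matrix ι (Fin 1) ℝ} {C : Matrix o ι ℝ} {u : Fin L → κ → ℝ}
    {ε : Fin L → Fin 1 → ℝ} {y : Fin L → o → ℝ} :
    IsTrajectory A B H C u ε y ↔
      IsLTITrajectory A (Matrix.fromCols H B) C (combinedInput u ε) y := by
  simp only [IsTrajectory, IsLTITrajectory, combinedInput, Matrix.fromCols_mulVec_sumElim,
    add_assoc, add_comm (_ *ᵥ u _)]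

theorem hankel_combinedInput_mulVec_eq_col_iff {ud : Fin T → κ → ℝ} {εd : Fin T → Fin 1 → ℝ}
    {u : Fin L → κ → ℝ} {ε : Fin L → Fin 1 → ℝ} {g : Fin (T + 1 - L) → ℝ} :
    hankel L (combinedInput ud εd) *ᵥ g = col (combinedInput u ε) ↔
      hankel L ud *ᵥ g = col u ∧ hankel L εd *ᵥ g = col ε := by
  simp only [funext_iff, Prod.forall, Sum.forall, ← forall_and]
  exact forall_congr' fun a => and_comm

theorem hankel_mulVec_eq_col_append_iff {w : Fin T → κ → ℝ} {v : Fin Tini → κ → ℝ}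
    {v' : Fin N → κ → ℝ} {g : Fin (T + 1 - (Tini + N)) → ℝ} :
    hankel (Tini + N) w *ᵥ g = col (Fin.append v v') ↔
      hankelPast Tini N w *ᵥ g = col v ∧ hankelFuture Tini N w *ᵥ g = col v' := by
  simp only [funext_iff, Prod.forall, Fin.forall_fin_add, col, Fin.append_left, Fin.append_right]
  rfl

theorem inDataRange_iff_exists_hankel {ud : Fin T → κ → ℝ} {εd : Fin T → Fin 1 → ℝ}
    {yd : Fin T → o → ℝ} {uini : Fin Tini → κ → ℝ} {εini : Fin Tini → Fin 1 → ℝ}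
    {yini : Fin Tini → o → ℝ} {u : Fin N → κ → ℝ} {ε : Fin N → Fin 1 → ℝ} {y : Fin N → o → ℝ} :
    InDataRange ud εd yd uini εini yini u ε y ↔ ∃ g : Fin (T + 1 - (Tini + N)) → ℝ,
      hankel (Tini + N) (combinedInput ud εd) *ᵥ g =
        col (combinedInput (Fin.append uini u) (Fin.append εini ε)) ∧
      hankel (Tini + N) yd *ᵥ g = col (Fin.append yini y) := by
  simp only [InDataRange, hankel_combinedInput_mulVec_eq_col_iff, hankel_mulVec_eq_col_append_iff]
  exact exists_congr fun g => by tauto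

theorem IsTrajectory.output_unique_of_inDataRange {ι : Type} [Fintype ι] [Fintype κ]
    {A : Matrix ι ι ℝ} {B : Matrix ι κ ℝ} {H : Matrix ι (Fin 1) ℝ} {C : Matrix o ι ℝ}
    {ud : Fin T → κ → ℝ} {εd : Fin T → Fin 1 → ℝ} {yd : Fin T → o → ℝ}
    (hdata : IsTrajectory A B H C ud εd yd) (hTini : Fintype.card ι ≤ Tini)
    {uini : Fin Tini → κ → ℝ} {εini : Fin Tini → Fin 1 → ℝ}
    {yini : Fin Tini → o → ℝ} {u : Fin N → κ → ℝ} {ε : Fin N → Fin 1 → ℝ} {y y' : Fin N → o → ℝ}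
    (h : InDataRange ud εd yd uini εini yini u ε y)
    (h' : InDataRange ud εd yd uini εini yini u ε y') : y = y' := by
  obtain ⟨g, hgw, hgy⟩ := inDataRange_iff_exists_hankel.1 h
  obtain ⟨g', hgw', hgy'⟩ := inDataRange_iff_exists_hankel.1 h'
  rw [isTrajectory_iff_isLTITrajectory] at hdata
  have happend : Fin.append yini y = Fin.append yini y' :=
    (hdata.of_hankel hgw hgy).output_unique (hdata.of_hankel hgw' hgy')
      (hTini.trans (Nat.le_add_right _ _)) fun k hk => by
        rw [← Fin.castAdd_castLT N k (hk.trans_le hTini), Fin.append_left, Fin.append_left]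
  exact funext fun k => by simpa only [Fin.append_right] using congrFun happend (Fin.natAdd Tini k)

theorem IsTrajectory.append_iff_inDataRange {ι : Type} [Fintype ι] [DecidableEq ι] [Fintype κ]
    {A : Matrix ι ι ℝ} {B : Matrix ι κ ℝ} {H : Matrix ι (Fin 1) ℝ} {C : Matrix o ι ℝ}
    {ud : Fin T → κ → ℝ} {εd : Fin T → Fin 1 → ℝ} {yd : Fin T → o → ℝ}
    (hctrl : IsControllable A (Matrix.fromCols H B)) (hdata : IsTrajectory A B H C ud εd yd)
    (hexc : PersistentlyExciting (Tini + N + Fintype.card ι) (combinedInput ud εd))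
    (uini : Fin Tini → κ → ℝ) (εini : Fin Tini → Fin 1 → ℝ) (yini : Fin Tini → o → ℝ)
    (u : Fin N → κ → ℝ) (ε : Fin N → Fin 1 → ℝ) (y : Fin N → o → ℝ) :
    IsTrajectory A B H C (Fin.append uini u) (Fin.append εini ε) (Fin.append yini y) ↔
      InDataRange ud εd yd uini εini yini u ε y := by
  rw [isTrajectory_iff_isLTITrajectory, inDataRange_iff_exists_hankel]
  exact (isTrajectory_iff_isLTITrajectory.1 hdata).iff_exists_hankel hctrl hexc

end DataRange

section MatrixExp

variable {ι : Type*} [Fintype ι] [DecidableEq ι]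

open scoped Matrix.Norms.Operator in
theorem hasSum_vecMul_exp (z : ι → ℂ) (M : Matrix ι ι ℂ) :
    HasSum (fun n : ℕ => (n.factorial : ℂ)⁻¹ • (z ᵥ* M ^ n)) (z ᵥ* NormedSpace.exp M) := by
  have hsum := (NormedSpace.exp_series_hasSum_exp' (𝕂 := ℂ) M).mapL
    (LinearMap.toContinuousLinearMap (Matrix.vecMulBilin ℂ ℂ z))
  simp only [map_smul] at hsum
  exact hsum

theorem vecMul_exp_of_vecMul_sq_eq_zero {z : ι → ℂ} {M : Matrix ι ι ℂ} (h : z ᵥ* M ᵥ* M = 0) :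
    z ᵥ* NormedSpace.exp M = z + z ᵥ* M := by
  have hvanish : ∀ n ∉ Finset.range 2, (n.factorial : ℂ)⁻¹ • (z ᵥ* M ^ n) = 0 := by
    intro n hn
    obtain ⟨k, rfl⟩ := Nat.exists_eq_add_of_le (not_lt.1 (mt Finset.mem_range.2 hn))
    rw [pow_add, pow_two, ← Matrix.vecMul_vecMul, ← Matrix.vecMul_vecMul, h, Matrix.zero_vecMul,
      smul_zero]
  refine (hasSum_vecMul_exp z M).unique ?_
  simpa [Finset.sum_range_succ] using hasSum_sum_of_ne_finset_zero hvanish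

theorem vecMul_exp_smul_of_vecMul_eq_smul_add {M : Matrix ι ι ℂ} {l : ℂ} {z r : ι → ℂ}
    (hz : z ᵥ* M = l • z + r) (hr : r ᵥ* M = l • r) (t : ℂ) :
    z ᵥ* NormedSpace.exp (t • M) = Complex.exp (t * l) • (z + t • r) := by
  set P := t • (M - l • 1)
  have hsplit : t • M = P + Matrix.diagonal fun _ => t * l := by
    rw [← Matrix.smul_one_eq_diagonal]
    module
  have hcomm : Commute P (Matrix.diagonal fun _ => t * l) := by
    rw [← Matrix.smul_one_eq_diagonal]
    exact (Commute.one_right _).smul_right _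
  have hzP : z ᵥ* P = t • r := by
    rw [Matrix.vecMul_smul, Matrix.vecMul_sub, hz, Matrix.vecMul_smul, Matrix.vecMul_one,
      add_sub_cancel_left]
  have hrP : (t • r) ᵥ* P = 0 := by
    rw [Matrix.smul_vecMul, Matrix.vecMul_smul, Matrix.vecMul_sub, hr, Matrix.vecMul_smul,
      Matrix.vecMul_one, sub_self, smul_zero, smul_zero]
  rw [hsplit, Matrix.exp_add_of_commute P _ hcomm, ← Matrix.vecMul_vecMul,
    vecMul_exp_of_vecMul_sq_eq_zero (M := P) (by rw [hzP, hrP]), hzP, Matrix.exp_diagonal]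
  ext i
  simp [Matrix.vecMul_diagonal, Complex.exp_eq_exp_ℂ, mul_comm]

theorem vecMul_exp_smul_of_vecMul_eq_smul {M : Matrix ι ι ℂ} {l : ℂ} {v : ι → ℂ}
    (hv : v ᵥ* M = l • v) (t : ℂ) : v ᵥ* NormedSpace.exp (t • M) = Complex.exp (t * l) • v := by
  simpa using vecMul_exp_smul_of_vecMul_eq_smul_add (r := 0) (by rw [hv, add_zero]) (by simp) t

theorem mem_spectrum_of_vecMul_eq_smul {K : Type*} [Field K] {M : Matrix ι ι K} {l : K}
    {v : ι → K} (hv : v ≠ 0) (h : v ᵥ* M = l • v) : l ∈ spectrum K M := by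
  rw [spectrum.mem_iff, Matrix.isUnit_iff_isUnit_det, isUnit_iff_ne_zero, not_not,
    ← Matrix.exists_vecMul_eq_zero_iff]
  refine ⟨v, hv, ?_⟩
  rw [Matrix.vecMul_sub, h, Algebra.algebraMap_eq_smul_one, Matrix.vecMul_smul, Matrix.vecMul_one,
    sub_self]

theorem vecMul_eq_smul_of_vecMul_exp_eq_smul {M : Matrix ι ι ℂ} {t μ l : ℂ} (ht : t ≠ 0) (k : ℕ)
    {v : ι → ℂ} (hv : v ᵥ* NormedSpace.exp (t • M) = μ • v)
    (hk : ((M.vecMulLinear - l • 1) ^ k) v = 0) : v ᵥ* M = l • v := by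
  induction k generalizing v with
  | zero => simp_all
  | succ k ih =>
    obtain ⟨r, hvr⟩ : ∃ r, v ᵥ* M = l • v + r := ⟨_, (add_sub_cancel _ _).symm⟩
    have hr : (M.vecMulLinear - l • 1) v = r := by simp [hvr]
    have hcomm : Commute M (NormedSpace.exp (t • M)) := ((Commute.refl M).smul_right t).exp_right
    have hr_exp : r ᵥ* NormedSpace.exp (t • M) = μ • r := by
      rw [← add_sub_cancel_left (l • v) r, ← hvr, Matrix.sub_vecMul, Matrix.vecMul_vecMul, hcomm.eq,
        ← Matrix.vecMul_vecMul, hv, Matrix.smul_vecMul, Matrix.smul_vecMul, hv, smul_sub,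
        smul_comm l]
    have hrM : r ᵥ* M = l • r :=
      ih hr_exp (by rwa [pow_succ, Module.End.mul_apply, hr] at hk)
    suffices hr0 : r = 0 by rw [hvr, hr0, add_zero]
    by_contra hr0
    -- `μ = e^{tl}` on `r`, so comparing the two values of `v e^{tM}` leaves `μ t r = 0`.
    have hμ : μ = Complex.exp (t * l) :=
      smul_left_injective ℂ hr0 (hr_exp.symm.trans (vecMul_exp_smul_of_vecMul_eq_smul hrM t))
    have hv_exp := vecMul_exp_smul_of_vecMul_eq_smul_add hvr hrM t
    rw [hv, hμ, smul_add, left_eq_add, smul_smul, smul_eq_zero] at hv_exp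
    exact hv_exp.elim (mul_ne_zero (Complex.exp_ne_zero _) ht) hr0

theorem exists_vecMul_eq_smul_of_vecMul_exp_eq_smul {M : Matrix ι ι ℂ} {t μ : ℂ} (ht : t ≠ 0)
    (hinj : Set.InjOn (fun l => Complex.exp (t * l)) (spectrum ℂ M)) {v : ι → ℂ}
    (hv : v ᵥ* NormedSpace.exp (t • M) = μ • v) : ∃ l : ℂ, v ᵥ* M = l • v := by
  let f : Module.End ℂ (ι → ℂ) := M.vecMulLinear
  let W := Module.End.eigenspace (NormedSpace.exp (t • M)).vecMulLinear μ
  have hW : ∀ {w}, w ∈ W ↔ w ᵥ* NormedSpace.exp (t • M) = μ • w := Module.End.mem_eigenspace_iff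
  have hcomm : Commute M (NormedSpace.exp (t • M)) := ((Commute.refl M).smul_right t).exp_right
  have hWf : ∀ w ∈ W, f w ∈ W := fun w hw => by
    rw [hW] at hw ⊢
    rw [Matrix.vecMulLinear_apply, Matrix.vecMul_vecMul, hcomm.eq, ← Matrix.vecMul_vecMul, hw,
      Matrix.smul_vecMul]
  -- `W` splits along the generalized eigenspaces of `M`, and by injectivity meets only one of them.
  have hW_eq : W = ⨆ l, W ⊓ f.maxGenEigenspace l :=
    Submodule.eq_iSup_inf_genEigenspace ⊤ hWf (Module.End.iSup_maxGenEigenspace_eq_top f)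
  have hsubsingleton : {l ∈ spectrum ℂ M | Complex.exp (t * l) = μ}.Subsingleton :=
    fun a ha b hb => hinj ha.1 hb.1 (ha.2.trans hb.2.symm)
  obtain ⟨l, hl⟩ : ∃ l, {l ∈ spectrum ℂ M | Complex.exp (t * l) = μ} ⊆ {l} := by
    rcases hsubsingleton.eq_empty_or_singleton with h | ⟨l, h⟩
    exacts [⟨0, h.subset.trans (Set.empty_subset _)⟩, ⟨l, h.subset⟩]
  have hle : ⨆ b, W ⊓ f.maxGenEigenspace b ≤ f.eigenspace l := by
    refine iSup_le fun b w ⟨hw, hwb⟩ => Module.End.mem_eigenspace_iff.2 ?_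
    obtain ⟨k, hk⟩ := Module.End.mem_maxGenEigenspace _ _ _ |>.1 hwb
    have hwM : w ᵥ* M = b • w := vecMul_eq_smul_of_vecMul_exp_eq_smul ht k (hW.1 hw) hk
    rcases eq_or_ne w 0 with rfl | hw0
    · simp
    · have hμ := (vecMul_exp_smul_of_vecMul_eq_smul hwM t).symm.trans (hW.1 hw)
      rw [← hl ⟨mem_spectrum_of_vecMul_eq_smul hw0 hwM, smul_left_injective ℂ hw0 hμ⟩]
      exact hwM
  exact ⟨l, Module.End.mem_eigenspace_iff.1 (hle (hW_eq ▸ hW.2 hv))⟩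

end MatrixExp

section Hautus

variable {ι κ K L : Type*} [Fintype ι] [Field K]

/-- The Popov–Belevitch–Hautus condition on the pair `(M, G)`: no left eigenvector of `M` is
annihilated by `G`. Unlike `IsControllable`, it is only meaningful when `K` contains the
eigenvalues of `M`. -/
def HautusCondition (M : Matrix ι ι K) (G : Matrix ι κ K) : Prop :=
  ∀ (l : K) (v : ι → K), v ᵥ* M = l • v → v ᵥ* G = 0 → v = 0

theorem HautusCondition.isControllable [DecidableEq ι] [IsAlgClosed K] {M : Matrix ι ι K}
    {G : Matrix ι κ K} (h : HautusCondition M G) : IsControllable M G := by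
  let U : Submodule K (ι → K) := ⨅ k, LinearMap.ker (G.vecMulLinear ∘ₗ (M ^ k).vecMulLinear)
  have hU : ∀ {z}, z ∈ U ↔ ∀ k, z ᵥ* M ^ k ᵥ* G = 0 := by
    simp [U, Submodule.mem_iInf]
  have hUM : ∀ z ∈ U, M.vecMulLinear z ∈ U := fun z hz => hU.2 fun k => by
    rw [Matrix.vecMulLinear_apply, Matrix.vecMul_vecMul z, ← pow_succ']
    exact hU.1 hz (k + 1)
  intro ξ hξ
  by_contra hne
  have : Nontrivial U := Submodule.nontrivial_iff_ne_bot.2 (U.ne_bot_iff.2 ⟨ξ, hU.2 hξ, hne⟩)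
  obtain ⟨l, hl⟩ := Module.End.exists_eigenvalue (M.vecMulLinear.restrict hUM)
  obtain ⟨z, hz⟩ := hl.exists_hasEigenvector
  refine hz.2 (Subtype.ext (h l z (congrArg Subtype.val hz.apply_eq_smul) ?_))
  simpa using hU.1 z.2 0

theorem IsControllable.of_map [DecidableEq ι] [Field L] (f : K →+* L) {A : Matrix ι ι K}
    {G : Matrix ι κ K} (h : IsControllable (A.map f) (G.map f)) : IsControllable A G := by
  intro ξ hξ
  have hmap : f ∘ ξ = 0 := h _ fun k => by
    have hpow : A.map f ^ k = (A ^ k).map f := (map_pow f.mapMatrix A k).symm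
    have hcomp : (f ∘ ξ) ᵥ* (A ^ k).map f = f ∘ (ξ ᵥ* A ^ k) :=
      funext fun i => (f.map_vecMul _ _ i).symm
    ext c
    rw [hpow, hcomp, ← f.map_vecMul, hξ k, Pi.zero_apply, map_zero, Pi.zero_apply]
  exact funext fun i => f.injective ((congrFun hmap i).trans (map_zero f).symm)

end Hautus

section Sampling

variable {ι κ : Type} [Fintype ι] [DecidableEq ι] {A : Matrix ι ι ℝ} {G : Matrix ι κ ℝ} {Δt : ℝ}

theorem SamplingCondition.injOn_exp (hΔt : 0 < Δt) (h : SamplingCondition A Δt) :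
    Set.InjOn (fun l => Complex.exp (Δt * l)) (spectrum ℂ (A.map (algebraMap ℝ ℂ))) := by
  intro a ha b hb hab
  obtain ⟨k, hk⟩ := Complex.exp_eq_exp_iff_exists_int.1 hab
  have hsub : a - b = ((2 * Real.pi * k / Δt : ℝ) : ℂ) * Complex.I := by
    have hΔt' : (Δt : ℂ) ≠ 0 := Complex.ofReal_ne_zero.2 hΔt.ne'
    push_cast
    field_simp
    linear_combination hk
  have hre : (a - b).re = 0 := by rw [hsub, Complex.re_ofReal_mul, Complex.I_re, mul_zero]
  have him : (a - b).im = 2 * Real.pi * k / Δt := by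
    rw [hsub, Complex.im_ofReal_mul, Complex.I_im, mul_one]
  rcases eq_or_ne k 0 with rfl | hk0
  · exact sub_eq_zero.1 (by simpa using hsub)
  · refine absurd ?_ (h a ha b hb hre k.natAbs (Int.natAbs_pos.2 hk0))
    rw [him, abs_div, abs_mul, abs_of_pos hΔt, abs_of_pos Real.two_pi_pos, Nat.cast_natAbs,
      Int.cast_abs]

theorem star_vecMul_map_ofReal {m n : Type*} [Fintype m] (A : Matrix m n ℝ) (v : m → ℂ) :
    star v ᵥ* A.map (algebraMap ℝ ℂ) = star (v ᵥ* A.map (algebraMap ℝ ℂ)) := by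
  ext i
  simp [Matrix.vecMul, dotProduct]

theorem SamplingCondition.integral_exp_ne_zero (hΔt : 0 < Δt) (h : SamplingCondition A Δt) {l : ℂ}
    {v : ι → ℂ} (hv : v ≠ 0) (hvA : v ᵥ* A.map (algebraMap ℝ ℂ) = l • v) :
    ∫ t in (0 : ℝ)..Δt, Complex.exp (l * t) ≠ 0 := by
  rcases eq_or_ne l 0 with rfl | hl
  · simpa using hΔt.ne'
  intro hint
  rw [integral_exp_mul_complex hl, div_eq_zero_iff, or_iff_left hl, sub_eq_zero] at hint
  have hexp : Complex.exp (Δt * l) = 1 := by simpa [mul_comm] using hint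
  have hexp_star : Complex.exp (Δt * star l) = 1 := by
    simpa [← Complex.exp_conj] using congrArg star hexp
  -- `star l` is an eigenvalue too, so `l` is real, and then `e^{lΔt} = 1` forces `l = 0`.
  have hvA_star : star v ᵥ* A.map (algebraMap ℝ ℂ) = star l • star v := by
    rw [star_vecMul_map_ofReal, hvA, star_smul]
  have hreal : star l = l := h.injOn_exp hΔt
    (mem_spectrum_of_vecMul_eq_smul (star_ne_zero.2 hv) hvA_star)
    (mem_spectrum_of_vecMul_eq_smul hv hvA) (hexp_star.trans hexp.symm)
  obtain ⟨r, rfl⟩ := Complex.conj_eq_iff_real.1 hreal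
  rw [← Complex.ofReal_mul, ← Complex.ofReal_exp, Complex.ofReal_eq_one, Real.exp_eq_one_iff,
    mul_eq_zero, or_iff_right hΔt.ne'] at hexp
  exact hl (by rw [hexp, Complex.ofReal_zero])

open scoped Matrix.Norms.Operator in
theorem map_ofReal_exp_smul (A : Matrix ι ι ℝ) (t : ℝ) :
    (NormedSpace.exp (t • A)).map (algebraMap ℝ ℂ) =
      NormedSpace.exp ((t : ℂ) • A.map (algebraMap ℝ ℂ)) := by
  have hcont : Continuous ((algebraMap ℝ ℂ).mapMatrix : Matrix ι ι ℝ →+* Matrix ι ι ℂ) :=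
    continuous_id.matrix_map Complex.continuous_ofReal
  have hsmul : (t • A).map (algebraMap ℝ ℂ) = (t : ℂ) • A.map (algebraMap ℝ ℂ) := by
    ext
    simp
  rw [← hsmul]
  exact NormedSpace.map_exp (algebraMap ℝ ℂ).mapMatrix hcont (t • A)

open scoped Matrix.Norms.Operator in
theorem continuous_exp_smul (A : Matrix ι ι ℝ) : Continuous fun t : ℝ => NormedSpace.exp (t • A) :=
  NormedSpace.exp_continuous.comp (continuous_id.smul continuous_const)

theorem vecMul_map_ofReal_discInput {l : ℂ} {v : ι → ℂ}
    (hv : v ᵥ* A.map (algebraMap ℝ ℂ) = l • v) (G : Matrix ι κ ℝ) (Δt : ℝ) :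
    v ᵥ* (discInput A G Δt).map (algebraMap ℝ ℂ) =
      (∫ t in (0 : ℝ)..Δt, Complex.exp (l * t)) • (v ᵥ* G.map (algebraMap ℝ ℂ)) := by
  have hcont : ∀ i c, Continuous fun t : ℝ => (NormedSpace.exp (t • A) * G) i c := fun i c =>
    ((continuous_exp_smul A).matrix_mul continuous_const).matrix_elem i c
  have hpointwise : ∀ t : ℝ, v ᵥ* (NormedSpace.exp (t • A) * G).map (algebraMap ℝ ℂ) =
      Complex.exp (l * t) • (v ᵥ* G.map (algebraMap ℝ ℂ)) := fun t => by
    rw [Matrix.map_mul, map_ofReal_exp_smul, ← Matrix.vecMul_vecMul,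
      vecMul_exp_smul_of_vecMul_eq_smul hv, Matrix.smul_vecMul, mul_comm]
  ext c
  calc (v ᵥ* (discInput A G Δt).map (algebraMap ℝ ℂ)) c
      = ∑ i, ∫ t in (0 : ℝ)..Δt, v i * ((NormedSpace.exp (t • A) * G) i c : ℂ) := by
        simp only [Matrix.vecMul, dotProduct, Matrix.map_apply, discInput, Matrix.of_apply,
          intervalIntegral.integral_const_mul, intervalIntegral.integral_ofReal,
          Complex.coe_algebraMap]
    _ = ∫ t in (0 : ℝ)..Δt, (v ᵥ* (NormedSpace.exp (t • A) * G).map (algebraMap ℝ ℂ)) c :=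
        (intervalIntegral.integral_finsetSum fun i _ => (continuous_const.mul
          (Complex.continuous_ofReal.comp (hcont i c))).intervalIntegrable _ _).symm
    _ = _ := by
        simp only [hpointwise, Pi.smul_apply, smul_eq_mul, intervalIntegral.integral_mul_const]

theorem HautusCondition.sampled
    (hHautus : HautusCondition (A.map (algebraMap ℝ ℂ)) (G.map (algebraMap ℝ ℂ))) (hΔt : 0 < Δt)
    (h : SamplingCondition A Δt) :
    HautusCondition ((discState A Δt).map (algebraMap ℝ ℂ))
      ((discInput A G Δt).map (algebraMap ℝ ℂ)) := by
  intro μ v hv hvG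
  by_contra hv0
  rw [discState, map_ofReal_exp_smul] at hv
  obtain ⟨l, hl⟩ := exists_vecMul_eq_smul_of_vecMul_exp_eq_smul
    (Complex.ofReal_ne_zero.2 hΔt.ne') (h.injOn_exp hΔt) hv
  rw [vecMul_map_ofReal_discInput hl, smul_eq_zero,
    or_iff_right (h.integral_exp_ne_zero hΔt hv0 hl)] at hvG
  exact hv0 (hHautus l v hl hvG)

theorem isControllable_sampled
    (hHautus : HautusCondition (A.map (algebraMap ℝ ℂ)) (G.map (algebraMap ℝ ℂ))) (hΔt : 0 < Δt)
    (h : SamplingCondition A Δt) : IsControllable (discState A Δt) (discInput A G Δt) :=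
  .of_map (algebraMap ℝ ℂ) (hHautus.sampled hΔt h).isControllable

theorem discInput_fromCols {τ : Type} (A : Matrix ι ι ℝ) (H : Matrix ι τ ℝ) (B : Matrix ι κ ℝ)
    (Δt : ℝ) : discInput A (Matrix.fromCols H B) Δt =
      Matrix.fromCols (discInput A H Δt) (discInput A B Δt) := by
  ext i (c | c) <;> simp [discInput, Matrix.mul_apply]

end Sampling

section Platoon

-- `q = s + α₃ w` satisfies `l q = (α₁ + l α₃) w`. If `α₁ + l α₃ = 0`, this gives `q = 0`
-- everywhere; otherwise `q i = 0` gives `w i = 0` and propagates along the platoon.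
theorem eq_zero_of_platoon_recurrence {K : Type*} [Field K] {α₁ α₂ α₃ l : K} (hα₁ : α₁ ≠ 0)
    (hparam : α₁ - α₂ * α₃ + α₃ ^ 2 ≠ 0) {n : ℕ} {s w : ℕ → K} (h0 : s 0 + α₃ * w 0 = 0)
    (hs : ∀ i, α₁ * w i = l * s i)
    (hw : ∀ i < n, -s i - α₂ * w i + (s (i + 1) + α₃ * w (i + 1)) = l * w i) :
    ∀ i < n, s i = 0 ∧ w i = 0 := by
  have hq : ∀ i, l * (s i + α₃ * w i) = (α₁ + l * α₃) * w i := fun i => by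
    linear_combination -hs i
  by_cases hl : α₁ + l * α₃ = 0
  · have hl0 : l ≠ 0 := by
      rintro rfl
      exact hα₁ (by simpa using hl)
    have hq0 : ∀ i, s i + α₃ * w i = 0 := fun i => by simpa [hl, hl0] using hq i
    intro i hi
    have hwi : w i = 0 := (mul_eq_zero.1 (by
      linear_combination α₃ * hw i hi + α₃ * hq0 i - α₃ * hq0 (i + 1) + w i * hl :
      (α₁ - α₂ * α₃ + α₃ ^ 2) * w i = 0)).resolve_left hparam
    exact ⟨by simpa [hwi] using hq0 i, hwi⟩
  · have hvanish : ∀ i, s i + α₃ * w i = 0 → s i = 0 ∧ w i = 0 := fun i hi => by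
      have hwi : w i = 0 := by simpa [hi, hl] using hq i
      exact ⟨by simpa [hwi] using hi, hwi⟩
    have hq0 : ∀ i ≤ n, s i + α₃ * w i = 0 := by
      intro i
      induction i with
      | zero => exact fun _ => h0
      | succ i ih =>
        intro hi
        obtain ⟨hsi, hwi⟩ := hvanish i (ih (by omega))
        simpa [hsi, hwi] using hw i hi
    exact fun i hi => hvanish i (hq0 i hi.le)

variable {n : ℕ}

theorem sum_ite_eq_or_succ_eq {M : Type*} [AddCommMonoid M] (i : Fin n) (X Y : Fin n → M) :
    (∑ k, if i = k then X k else if (i : ℕ) + 1 = k then Y k else 0) =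
      X i + if h : (i : ℕ) + 1 < n then Y ⟨i + 1, h⟩ else 0 := by
  rw [← Finset.add_sum_erase _ _ (Finset.mem_univ i), if_pos rfl]
  congr 1
  have hne : ∀ k ∈ Finset.univ.erase i, (if i = k then X k else if (i : ℕ) + 1 = k then Y k else 0)
      = if (i : ℕ) + 1 = k then Y k else 0 := fun k hk => if_neg (Finset.ne_of_mem_erase hk).symm
  rw [Finset.sum_congr rfl hne]
  split_ifs with h
  · rw [Finset.sum_eq_single_of_mem ⟨i + 1, h⟩ (by simp [Fin.ext_iff]), if_pos rfl]
    exact fun k _ hk => if_neg fun hik => hk (Fin.ext hik.symm)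
  · exact Finset.sum_eq_zero fun k _ => if_neg fun hik : (i : ℕ) + 1 = k => h (hik ▸ k.2)

/-- The `c`-components of a covector `v` on the platoon as a sequence, continued by zero behind
the last vehicle, so that the last vehicle satisfies the same equations as the others. -/
def padded (v : StateIdx n → ℂ) (c : Fin 2) (k : ℕ) : ℂ :=
  if h : k < n then v (⟨k, h⟩, c) else 0

theorem padded_val (v : StateIdx n → ℂ) (c : Fin 2) (i : Fin n) : padded v c i = v (i, c) :=
  dif_pos i.2

variable {S : Finset (Fin n)} (α₁ α₂ α₃ η : ℝ) {v : StateIdx n → ℂ}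

theorem vecMul_matB (v : StateIdx n → ℂ) (i : S) :
    (v ᵥ* (matB S).map (algebraMap ℝ ℂ)) i = v (i, 1) := by
  simp [Matrix.vecMul, dotProduct, matB, apply_ite ((↑) : ℝ → ℂ)]

theorem vecMul_matH [NeZero n] (v : StateIdx n → ℂ) (c : Fin 1) :
    (v ᵥ* (matH n η).map (algebraMap ℝ ℂ)) c = v (0, 0) + η * v (0, 1) := by
  simp [Matrix.vecMul, dotProduct, matH, Fintype.sum_prod_type, Fin.val_eq_zero_iff,
    apply_ite, mul_comm]

-- Where the velocity components of the CAVs vanish, the rows of the CAVs and of the HDVs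
-- contribute in the same way.
theorem vecMul_matA_spacing (hv : ∀ i ∈ S, v (i, 1) = 0) (i : Fin n) :
    (v ᵥ* (matA S α₁ α₂ α₃).map (algebraMap ℝ ℂ)) (i, 0) = α₁ * v (i, 1) := by
  calc (v ᵥ* (matA S α₁ α₂ α₃).map (algebraMap ℝ ℂ)) (i, 0)
      = ∑ k, if i = k then α₁ * v (k, 1) else if (i : ℕ) + 1 = k then 0 else 0 := by
        simp only [Matrix.vecMul, dotProduct, Fintype.sum_prod_type, Fin.sum_univ_two, matA,
          Matrix.map_apply, Matrix.of_apply]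
        refine Finset.sum_congr rfl fun k _ => ?_
        split_ifs with _ hk <;> simp [*, blockS1, blockP1, blockS2, blockP2, mul_comm]
    _ = _ := by rw [sum_ite_eq_or_succ_eq, dite_eq_ite, ite_self, add_zero]

theorem vecMul_matA_velocity (hv : ∀ i ∈ S, v (i, 1) = 0) (i : Fin n) :
    (v ᵥ* (matA S α₁ α₂ α₃).map (algebraMap ℝ ℂ)) (i, 1) =
      -v (i, 0) - α₂ * v (i, 1) + (padded v 0 (i + 1) + α₃ * padded v 1 (i + 1)) := by
  calc (v ᵥ* (matA S α₁ α₂ α₃).map (algebraMap ℝ ℂ)) (i, 1)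
      = ∑ k, if i = k then -v (k, 0) - α₂ * v (k, 1) else
          if (i : ℕ) + 1 = k then v (k, 0) + α₃ * v (k, 1) else 0 := by
        simp only [Matrix.vecMul, dotProduct, Fintype.sum_prod_type, Fin.sum_univ_two, matA,
          Matrix.map_apply, Matrix.of_apply]
        refine Finset.sum_congr rfl fun k _ => ?_
        split_ifs <;> simp [*, blockS1, blockP1, blockS2, blockP2, mul_comm, sub_eq_add_neg]
    _ = _ := by
        rw [sum_ite_eq_or_succ_eq]
        simp only [padded]
        split_ifs <;> simp

theorem hautusCondition_traffic {α₁ α₂ α₃ η : ℝ} (hα₁ : α₁ ≠ 0)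
    (hη : ∀ i ∉ S, (i : ℕ) = 0 → η = α₃) (hparam : α₁ - α₂ * α₃ + α₃ ^ 2 ≠ 0) :
    HautusCondition ((matA S α₁ α₂ α₃).map (algebraMap ℝ ℂ))
      ((Matrix.fromCols (matH n η) (matB S)).map (algebraMap ℝ ℂ)) := by
  intro l v hA hG
  have hB : ∀ i ∈ S, v (i, 1) = 0 := fun i hi =>
    (vecMul_matB v ⟨i, hi⟩).symm.trans (congrFun hG (.inr ⟨i, hi⟩))
  have hhead : padded v 0 0 + α₃ * padded v 1 0 = 0 := by
    rcases Nat.eq_zero_or_pos n with rfl | hn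
    · simp [padded]
    have : NeZero n := ⟨hn.ne'⟩
    have hH : v (0, 0) + η * v (0, 1) = 0 := (vecMul_matH η v 0).symm.trans (congrFun hG (.inl 0))
    rw [← Fin.val_zero n, padded_val, padded_val]
    by_cases h0 : (0 : Fin n) ∈ S
    · rwa [hB 0 h0, mul_zero] at hH ⊢
    · rwa [hη 0 h0 rfl] at hH
  have hspacing : ∀ i, α₁ * padded v 1 i = l * padded v 0 i := fun i => by
    by_cases hi : i < n
    · have h := congrFun hA (⟨i, hi⟩, 0)
      rwa [vecMul_matA_spacing α₁ α₂ α₃ hB, Pi.smul_apply, smul_eq_mul, ← padded_val v,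
        ← padded_val v] at h
    · simp [padded, hi]
  have hvelocity : ∀ i < n, -padded v 0 i - α₂ * padded v 1 i +
      (padded v 0 (i + 1) + α₃ * padded v 1 (i + 1)) = l * padded v 1 i := fun i hi => by
    have h := congrFun hA (⟨i, hi⟩, 1)
    rwa [vecMul_matA_velocity α₁ α₂ α₃ hB, Pi.smul_apply, smul_eq_mul,
      ← padded_val v, ← padded_val v] at h
  have hzero := eq_zero_of_platoon_recurrence (Complex.ofReal_ne_zero.2 hα₁)
    (by exact_mod_cast hparam) hhead hspacing hvelocity
  funext ⟨i, c⟩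
  rw [← padded_val v]
  fin_cases c
  exacts [(hzero i i.2).1, (hzero i i.2).2]

end Platoon

end MixedTraffic

theorem proposition2_general {n : ℕ} (S : Finset (Fin n)) (α₁ α₂ α₃ η Δt : ℝ)
    (hα₁ : α₁ ≠ 0) (hη : ∀ i ∉ S, (i : ℕ) = 0 → η = α₃)
    (hΔt : 0 < Δt)
    (hparam : α₁ - α₂ * α₃ + α₃ ^ 2 ≠ 0)
    (hsampling : MixedTraffic.SamplingCondition (MixedTraffic.matA S α₁ α₂ α₃) Δt)
    (T Tini N : ℕ)
    (ud : Fin T → S → ℝ) (εd : Fin T → Fin 1 → ℝ) (yd : Fin T → MixedTraffic.OutIdx S → ℝ)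
    (hdata : MixedTraffic.IsTrafficTrajectory S α₁ α₂ α₃ η Δt ud εd yd)
    (hexc : MixedTraffic.PersistentlyExciting (Tini + N + 2 * n)
      (MixedTraffic.combinedInput ud εd)) :
    (∀ (uini : Fin Tini → S → ℝ) (εini : Fin Tini → Fin 1 → ℝ)
        (yini : Fin Tini → MixedTraffic.OutIdx S → ℝ)
        (u : Fin N → S → ℝ) (ε : Fin N → Fin 1 → ℝ) (y : Fin N → MixedTraffic.OutIdx S → ℝ),
      MixedTraffic.IsTrafficTrajectory S α₁ α₂ α₃ η Δt
          (Fin.append uini u) (Fin.append εini ε) (Fin.append yini y) ↔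
        MixedTraffic.InDataRange ud εd yd uini εini yini u ε y) ∧
    (2 * n ≤ Tini →
      ∀ (uini : Fin Tini → S → ℝ) (εini : Fin Tini → Fin 1 → ℝ)
        (yini : Fin Tini → MixedTraffic.OutIdx S → ℝ)
        (u : Fin N → S → ℝ) (ε : Fin N → Fin 1 → ℝ)
        (y y' : Fin N → MixedTraffic.OutIdx S → ℝ),
        MixedTraffic.InDataRange ud εd yd uini εini yini u ε y →
        MixedTraffic.InDataRange ud εd yd uini εini yini u ε y' → y = y') := by
  have hcard : Fintype.card (MixedTraffic.StateIdx n) = 2 * n := by simp [mul_comm]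
  rw [← hcard] at hexc ⊢
  have hctrl := MixedTraffic.isControllable_sampled
    (MixedTraffic.hautusCondition_traffic hα₁ hη hparam) hΔt hsampling
  rw [MixedTraffic.discInput_fromCols] at hctrl
  exact ⟨MixedTraffic.IsTrajectory.append_iff_inDataRange hctrl hdata hexc,
    fun hTini _ _ _ _ _ _ _ =>
      MixedTraffic.IsTrajectory.output_unique_of_inDataRange hdata hTini⟩

theorem proposition2 {n : ℕ} (S : Finset (Fin n)) (α₁ α₂ α₃ η Δt : ℝ)
    (hα₁ : 0 < α₁) (hα₃ : 0 < α₃) (hα₂ : α₃ < α₂)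
    (hη : η = α₃ ∨ (η = 0 ∧ ∃ i ∈ S, (i : ℕ) = 0))
    (hΔt : 0 < Δt)
    (hparam : α₁ - α₂ * α₃ + α₃ ^ 2 ≠ 0)
    (hsampling : MixedTraffic.SamplingCondition (MixedTraffic.matA S α₁ α₂ α₃) Δt)
    (T Tini N : ℕ)
    (ud : Fin T → S → ℝ) (εd : Fin T → Fin 1 → ℝ) (yd : Fin T → MixedTraffic.OutIdx S → ℝ)
    (hdata : MixedTraffic.IsTrafficTrajectory S α₁ α₂ α₃ η Δt ud εd yd)
    (hexc : MixedTraffic.PersistentlyExciting (Tini + N + 2 * n)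
      (MixedTraffic.combinedInput ud εd)) :
    (∀ (uini : Fin Tini → S → ℝ) (εini : Fin Tini → Fin 1 → ℝ)
        (yini : Fin Tini → MixedTraffic.OutIdx S → ℝ)
        (u : Fin N → S → ℝ) (ε : Fin N → Fin 1 → ℝ) (y : Fin N → MixedTraffic.OutIdx S → ℝ),
      MixedTraffic.IsTrafficTrajectory S α₁ α₂ α₃ η Δt
          (Fin.append uini u) (Fin.append εini ε) (Fin.append yini y) ↔
        MixedTraffic.InDataRange ud εd yd uini εini yini u ε y) ∧
    (2 * n ≤ Tini →
      ∀ (uini : Fin Tini → S → ℝ) (εini : Fin Tini → Fin 1 → ℝ)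
        (yini : Fin Tini → MixedTraffic.OutIdx S → ℝ)
        (u : Fin N → S → ℝ) (ε : Fin N → Fin 1 → ℝ)
        (y y' : Fin N → MixedTraffic.OutIdx S → ℝ),
        MixedTraffic.InDataRange ud εd yd uini εini yini u ε y →
        MixedTraffic.InDataRange ud εd yd uini εini yini u ε y' → y = y') :=
  proposition2_general S α₁ α₂ α₃ η Δt hα₁.ne' (fun _ hi hi0 => hη.resolve_right fun ⟨_, _, hj, hj0⟩
    => hi (Fin.ext (hj0.trans hi0.symm) ▸ hj)) hΔt hparam hsampling T Tini N ud εd yd hdata hexc
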